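/- Let $(\Omega,\mathcal F,(\mathcal F_t)_{t=0,\dots,T},\mathsf P)$ be a filtered probability space, $d\in\mathbb N$ and $p\in[1,\infty]$. Random vectors are identified if they are a.s. equal. $L^0(\mathbb R^d,\mathcal H)$ is the set of $\mathcal H$-measurable random vectors, $L^0(\Gamma,\mathcal H)$ the set of $\xi\in L^0(\mathbb R^d,\mathcal H)$ with $\xi\in\Gamma$ a.s., and $\mathrm{cl}_0$ is the closure in probability. $L^{p_{\mathcal H}}(\mathbb R^d,\mathcal G)$ is the set of $\xi\in L^0(\mathbb R^d,\mathcal G)$ for which $|||\xi|||_{p,\mathcal H}=\mathsf E(\|\xi\|^p|\mathcal H)^{1/p}$ (for $p=\infty$: the $\mathcal H$-conditional essential supremum of $\|\xi\|$) is a.s. finite. In it, $\xi_n\to\xi$ means $|||\xi_n-\xi|||_{p,\mathcal H}\to0$ in probability if $p<\infty$; if $p=\infty$ it means that all $\|\xi_n\|$ are a.s. bounded by one finite $\mathcal H$-measurable random variable and $\mathsf E(\|\xi_n-\xi\|\wedge1\,|\,\mathcal H)\to0$ in probability. *Acceptance sets.* Let $\mathcal C_{t,s}\subseteq L^{p_{\mathcal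 F_t}}(\mathbb R^d,\mathcal F_s)+L^0(\mathbb R_+^d,\mathcal F_s)$, $0\le t\le s\le T$, satisfy for all $t\le s$: (i) $\mathcal C_{t,s}\supseteq L^0(\mathbb R^d_+,\mathcal F_s)$ and $\mathcal C_{t,s}\cap L^0(\mathbb R^d_-,\mathcal F_s)=\{0\}$; (ii) $\mathcal C_{t,s}=(\mathcal C_{t,s}\cap L^{p_{\mathcal F_t}}(\mathbb R^d,\mathcal F_s))+L^0(\mathbb R^d_+,\mathcal F_s)$; (iii) $\mathcal C_{t,s}\cap L^{p_{\mathcal F_t}}(\mathbb R^d,\mathcal F_T)$ is (sequentially) closed in $L^{p_{\mathcal F_t}}(\mathbb R^d,\mathcal F_T)$; (iv) $\alpha\eta'+(1-\alpha)\eta''\in\mathcal C_{t,s}$ for all $\eta',\eta''\in\mathcal C_{t,s}$ and $\alpha\in L^0([0,1],\mathcal F_t)$; (v) $\mathcal C_{t,s}\cap L^0(\mathbb R^d,\mathcal F_u)=\mathcal C_{t,u}$ for $t\le u\le s$; (vi) $(\xi+\mathcal C_{t,s})\cap L^0(\mathbb R^d,\mathcal F_t)\ne\emptyset$ for $\xi\in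 L^{p_{\mathcal F_t}}(\mathbb R^d,\mathcal F_s)$, and $(\xi+\mathcal C_{t,s})\cap L^p(\mathbb R^d,\mathcal F_t)\neq\emptyset$ for $\xi\in L^p(\mathbb R^d,\mathcal F_s)$. *Solvency sets.* For $t=0,\dots,T$ let $\mathbf K_t$ be an $\mathcal F_t$-measurable random closed convex set in $\mathbb R^d$ (measurability of the graph) such that a.s. $\mathbf K_t+\mathbb R^d_+\subseteq\mathbf K_t$ and $\mathbf K_t\cap\mathbb R^d_-=\{0\}$. Let $\mathbf K^0_t=\bigcap_{c\ne0}c\mathbf K_t$ be the largest linear subspace contained in $\mathbf K_t$. The solvency sets are proper if $\mathbf K_t^0=\{0\}$ a.s. for all $t$. *Superhedging prices of the zero claim.* For $\Xi\subseteq L^0(\mathbb R^d,\mathcal F_T)$ let $\mathsf R^0_{t,s}(\Xi)$ be the set of all $\gamma\in L^0(\mathbb R^d,\mathcal F_t)$ with $\gamma-\xi\in\mathcal C_{t,s}$ for some $\xi\in\Xi$, and $\mathsf R_{t,s}(\Xi)=\mathrm{cl}_0\,\mathsf R^0_{t,s}(\Xi)$. Put $\Xi_T^0=\hat\Xi_T^0=L^0(\mathbf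 K_T,\mathcal F_T)$ and, for $t=T-1,\dots,0$, $$\Xi_t^0=L^0(\mathbf K_t,\mathcal F_t)+\mathsf R^0_{t,t+1}(\Xi_{t+1}^0),\qquad \hat\Xi_t^0=L^0(\mathbf K_t,\mathcal F_t)+\mathsf R_{t,t+1}(\Xi_{t+1}^0).$$ **Theorem.** Assume that the solvency sets are proper and that strict no risk arbitrage (SNR) holds: $$\hat\Xi_t^0\cap L^0(-\mathbf K_t,\mathcal F_t)\subseteq L^0(\mathbf K_t^0,\mathcal F_t)\quad\text{for all }t=0,\dots,T.$$ Then there is no asymptotic risk arbitrage (NARA), that is, $$(\mathrm{cl}_0\,\Xi_t^0)\cap L^0(\mathbb R^d_-,\mathcal F_t)=\{0\}\quad\text{for all }t=0,\dots,T,$$ and $\hat\Xi_t^0$ is closed in $L^0$ for all $t=0,\dots,T$. -/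

import Mathlib

open MeasureTheory Filter Topology
open scoped ENNReal NNReal Pointwise

noncomputable section

namespace RiskArbitrage

/-- The space `ℝ^d` with its Euclidean norm. -/
abbrev E (d : ℕ) : Type := EuclideanSpace ℝ (Fin d)

/-- Random vectors in `ℝ^d` up to a.s. equality. -/
abbrev RV {Ω : Type*} {m0 : MeasurableSpace Ω} (P : Measure Ω) (d : ℕ) : Type _ := Ω →ₘ[P] E d

section L0

variable {Ω : Type*} {m0 : MeasurableSpace Ω}

/-- `L⁰(ℝ^d, 𝓗)`: random vectors (up to a.s. equality) that are `𝓗`-measurable, that is, which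
coincide a.s. with an `𝓗`-measurable random vector. -/
def L0 (P : Measure Ω) (d : ℕ) (H : MeasurableSpace Ω) : Set (RV P d) :=
  {ξ | AEStronglyMeasurable[H] ξ P}

/-- `L⁰(Γ, 𝓗)`: the `𝓗`-measurable a.s. selections of a set-valued map `Γ`. -/
def selections (P : Measure Ω) {d : ℕ} (Γ : Ω → Set (E d)) (H : MeasurableSpace Ω) :
    Set (RV P d) :=
  {ξ | ξ ∈ L0 P d H ∧ ∀ᵐ ω ∂P, ξ ω ∈ Γ ω}

/-- The nonnegative orthant `ℝ_+^d`. -/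
def orthant (d : ℕ) : Set (E d) := {x | ∀ i, 0 ≤ x i}

/-- `L⁰(ℝ_+^d, 𝓗)`. -/
def L0pos (P : Measure Ω) (d : ℕ) (H : MeasurableSpace Ω) : Set (RV P d) :=
  selections P (fun _ => orthant d) H

/-- `L⁰(ℝ_-^d, 𝓗)`. -/
def L0neg (P : Measure Ω) (d : ℕ) (H : MeasurableSpace Ω) : Set (RV P d) :=
  selections P (fun _ => -orthant d) H

/-- Product of a random variable and a random vector. -/
def rsmul {P : Measure Ω} {d : ℕ} (α : Ω →ₘ[P] ℝ) (ξ : RV P d) : RV P d :=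
  AEEqFun.comp₂ (fun (a : ℝ) (x : E d) => a • x) continuous_smul α ξ

/-- The closure of a family of random vectors in `L⁰`, that is, with respect to convergence in
probability (which is metrizable, so that sequences suffice). -/
def closureL0 {P : Measure Ω} {d : ℕ} (S : Set (RV P d)) : Set (RV P d) :=
  {ξ | ∃ u : ℕ → RV P d, (∀ n, u n ∈ S) ∧
    TendstoInMeasure P (fun n => (u n : Ω → E d)) atTop (ξ : Ω → E d)}

/-- Closedness in `L⁰`. -/
def IsClosedL0 {P : Measure Ω} {d : ℕ} (S : Set (RV P d)) : Prop :=
  closureL0 S ⊆ S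

end L0

section CondNorm

variable {Ω : Type*} {m0 : MeasurableSpace Ω}

/-- `g` is (a version of) the `𝓗`-conditional essential supremum of `X`: the a.s. smallest
`𝓗`-measurable random variable with values in `[0,∞]` that dominates `X` a.s. -/
def IsCondEssSup (P : Measure Ω) (H : MeasurableSpace Ω) (X g : Ω → ℝ≥0∞) : Prop :=
  Measurable[H] g ∧ X ≤ᵐ[P] g ∧ ∀ g' : Ω → ℝ≥0∞, Measurable[H] g' → X ≤ᵐ[P] g' → g ≤ᵐ[P] g'

/-- The conditional `p`-norm `E(‖ξ‖^p | 𝓗)^{1/p}` for `p ∈ [1,∞)`. -/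
def condNorm {P : Measure Ω} {d : ℕ} (p : ℝ≥0∞) (H : MeasurableSpace Ω) (ξ : RV P d) :
    Ω → ℝ≥0∞ :=
  fun ω => (condLExp H P (fun ω' => ‖ξ ω'‖ₑ ^ p.toReal) ω) ^ (1 / p.toReal)

/-- `L^{p_𝓗}(ℝ^d, 𝓖)`: the `𝓖`-measurable random vectors whose `𝓗`-conditional `p`-norm
(the conditional essential supremum of the norm if `p = ∞`) is a.s. finite. -/
def LpCond (P : Measure Ω) (d : ℕ) (p : ℝ≥0∞) (H G : MeasurableSpace Ω) :
    Set (RV P d) :=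
  {ξ | ξ ∈ L0 P d G ∧
    ((p ≠ ∞ ∧ ∀ᵐ ω ∂P, condNorm p H ξ ω < ∞) ∨
     (p = ∞ ∧ ∃ g, IsCondEssSup P H (fun ω => ‖ξ ω‖ₑ) g ∧ ∀ᵐ ω ∂P, g ω < ∞))}

/-- The random vectors `ξ' + ξ''` with `ξ' ∈ L^{p_𝓗}(ℝ^d, 𝓖)` and `ξ'' ∈ L⁰(ℝ_+^d, 𝓖)`. -/
def LpCondBar (P : Measure Ω) (d : ℕ) (p : ℝ≥0∞) (H G : MeasurableSpace Ω) : Set (RV P d) :=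
  LpCond P d p H G + L0pos P d G

/-- `L^p(ℝ^d, 𝓖)`. -/
def LpUncond (P : Measure Ω) (d : ℕ) (p : ℝ≥0∞) (G : MeasurableSpace Ω) : Set (RV P d) :=
  {ξ | ξ ∈ L0 P d G ∧ MemLp ξ p P}

/-- Convergence in `L^{p_𝓗}`. If `p < ∞`, the conditional `p`-norm of `u n - ξ` converges to `0`
in probability. If `p = ∞`, this is `𝓗`-bounded convergence in probability: all `‖u n‖` (hence
their `𝓗`-conditional essential suprema) are dominated by one finite `𝓗`-measurable random
variable, and `E(‖u n - ξ‖ ∧ 1 | 𝓗) → 0` in probability. -/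
def TendstoLpCond {P : Measure Ω} {d : ℕ} (p : ℝ≥0∞) (H : MeasurableSpace Ω)
    (u : ℕ → RV P d) (ξ : RV P d) : Prop :=
  (p ≠ ∞ ∧ ∀ ε : ℝ≥0∞, 0 < ε →
    Tendsto (fun n => P {ω | ε ≤ condNorm p H (u n - ξ) ω}) atTop (𝓝 0)) ∨
  (p = ∞ ∧
    (∃ b : Ω → ℝ≥0, Measurable[H] b ∧ ∀ n, ∀ᵐ ω ∂P, ‖u n ω‖ₑ ≤ (b ω : ℝ≥0∞)) ∧
    ∀ ε : ℝ≥0∞, 0 < ε →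
      Tendsto (fun n => P {ω | ε ≤ condLExp H P (fun ω' => min ‖(u n - ξ) ω'‖ₑ 1) ω})
        atTop (𝓝 0))

end CondNorm

section Model

variable {Ω : Type*} {m0 : MeasurableSpace Ω}

/-- `L^p`-dynamic convex acceptance sets `C t s`, `0 ≤ t ≤ s ≤ T`, in `ℝ^d`. Only the indices
`t ≤ s ≤ T` matter. -/
structure IsAcceptance (P : Measure Ω) (d T : ℕ) (ℱ : Filtration ℕ m0) (p : ℝ≥0∞)
    (C : ℕ → ℕ → Set (RV P d)) : Prop where
  subset_bar : ∀ t s, t ≤ s → s ≤ T → C t s ⊆ LpCondBar P d p (ℱ t) (ℱ s)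
  normal_pos : ∀ t s, t ≤ s → s ≤ T → L0pos P d (ℱ s) ⊆ C t s
  normal_neg : ∀ t s, t ≤ s → s ≤ T → C t s ∩ L0neg P d (ℱ s) = {0}
  integrability : ∀ t s, t ≤ s → s ≤ T →
    C t s = (C t s ∩ LpCond P d p (ℱ t) (ℱ s)) + L0pos P d (ℱ s)
  closed : ∀ t s, t ≤ s → s ≤ T → ∀ (u : ℕ → RV P d) (ξ : RV P d),
    (∀ n, u n ∈ C t s ∩ LpCond P d p (ℱ t) (ℱ T)) → ξ ∈ LpCond P d p (ℱ t) (ℱ T) →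
    TendstoLpCond p (ℱ t) u ξ → ξ ∈ C t s
  cond_convex : ∀ t s, t ≤ s → s ≤ T → ∀ α : Ω →ₘ[P] ℝ, AEStronglyMeasurable[ℱ t] α P →
    (∀ᵐ ω ∂P, 0 ≤ α ω ∧ α ω ≤ 1) → ∀ η' ∈ C t s, ∀ η'' ∈ C t s,
    rsmul α η' + rsmul (1 - α) η'' ∈ C t s
  time_consistent : ∀ t u s, t ≤ u → u ≤ s → s ≤ T → C t s ∩ L0 P d (ℱ u) = C t u
  compensation : ∀ t s, t ≤ s → s ≤ T → ∀ ξ ∈ LpCond P d p (ℱ t) (ℱ s),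
    (({ξ} + C t s) ∩ L0 P d (ℱ t)).Nonempty
  compensation_Lp : ∀ t s, t ≤ s → s ≤ T → ∀ ξ ∈ LpUncond P d p (ℱ s),
    (({ξ} + C t s) ∩ LpUncond P d p (ℱ t)).Nonempty

/-- Solvency sets `K t`, `t = 0, …, T`: `ℱ t`-measurable random closed convex upper sets in `ℝ^d`
with `K t ∩ ℝ_-^d = {0}`. Measurability means measurability of the graph. -/
structure IsSolvency (P : Measure Ω) (d T : ℕ) (ℱ : Filtration ℕ m0)
    (K : ℕ → Ω → Set (E d)) : Prop where
  measurable : ∀ t ≤ T, @MeasurableSet (Ω × E d)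
    (MeasurableSpace.prod (ℱ t) (borel (E d))) {q : Ω × E d | q.2 ∈ K t q.1}
  closed : ∀ t ≤ T, ∀ᵐ ω ∂P, IsClosed (K t ω)
  convex : ∀ t ≤ T, ∀ᵐ ω ∂P, Convex ℝ (K t ω)
  upper : ∀ t ≤ T, ∀ᵐ ω ∂P, K t ω + orthant d ⊆ K t ω
  inter_neg : ∀ t ≤ T, ∀ᵐ ω ∂P, K t ω ∩ (-orthant d) = {0}

/-- `K^0 = ⋂_{c ≠ 0} c K`, the largest linear subspace contained in a closed convex set `K ∋ 0`. -/
def linealityPart {d : ℕ} (K : Set (E d)) : Set (E d) :=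
  ⋂ c ∈ {c : ℝ | c ≠ 0}, c • K

/-- The solvency sets are proper: `K_t^0 = {0}` a.s. for all `t = 0, …, T`. -/
def IsProper (P : Measure Ω) {d : ℕ} (T : ℕ) (K : ℕ → Ω → Set (E d)) : Prop :=
  ∀ t ≤ T, ∀ᵐ ω ∂P, linealityPart (K t ω) = {0}

variable {P : Measure Ω} {d : ℕ}

/-- `R⁰_{t,s}(Ξ)`: all `γ ∈ L⁰(ℝ^d, ℱ t)` with `γ - ξ ∈ C t s` for some `ξ ∈ Ξ`. -/
def R0 (ℱ : Filtration ℕ m0) (C : ℕ → ℕ → Set (RV P d)) (t s : ℕ)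
    (Ξ : Set (RV P d)) : Set (RV P d) :=
  {γ | γ ∈ L0 P d (ℱ t) ∧ ∃ ξ ∈ Ξ, γ - ξ ∈ C t s}

/-- The dynamic selection risk measure `R_{t,s}(Ξ)`, the `L⁰`-closure of `R⁰_{t,s}(Ξ)`. -/
def R (ℱ : Filtration ℕ m0) (C : ℕ → ℕ → Set (RV P d)) (t s : ℕ)
    (Ξ : Set (RV P d)) : Set (RV P d) :=
  closureL0 (R0 ℱ C t s Ξ)

/-- The superhedging prices `Ξ_t^ξ` of the claim `ξ`: `Ξ_T^ξ = L⁰(ξ + K_T, ℱ T)` and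
`Ξ_t^ξ = L⁰(K_t, ℱ t) + R⁰_{t,t+1}(Ξ_{t+1}^ξ)` for `t < T`. -/
def Xi (T : ℕ) (ℱ : Filtration ℕ m0) (C : ℕ → ℕ → Set (RV P d))
    (K : ℕ → Ω → Set (E d)) (ξ : RV P d) (t : ℕ) : Set (RV P d) :=
  if t < T then
    selections P (K t) (ℱ t) + R0 ℱ C t (t + 1) (Xi T ℱ C K ξ (t + 1))
  else selections P (fun ω => {ξ ω} + K T ω) (ℱ T)
termination_by T - t

/-- The asymptotic superhedging prices `Ξ̂_t^ξ` of the claim `ξ`: `Ξ̂_T^ξ = Ξ_T^ξ` and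
`Ξ̂_t^ξ = L⁰(K_t, ℱ t) + R_{t,t+1}(Ξ_{t+1}^ξ)` for `t < T`. -/
def XiHat (T : ℕ) (ℱ : Filtration ℕ m0) (C : ℕ → ℕ → Set (RV P d))
    (K : ℕ → Ω → Set (E d)) (ξ : RV P d) (t : ℕ) : Set (RV P d) :=
  if t < T then
    selections P (K t) (ℱ t) + R ℱ C t (t + 1) (Xi T ℱ C K ξ (t + 1))
  else Xi T ℱ C K ξ T

/-- Strict no risk arbitrage:
`Ξ̂_t^0 ∩ L⁰(-K_t, ℱ t) ⊆ L⁰(K_t^0, ℱ t)` for all `t = 0, …, T`. -/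
def SNR (T : ℕ) (ℱ : Filtration ℕ m0) (C : ℕ → ℕ → Set (RV P d))
    (K : ℕ → Ω → Set (E d)) : Prop :=
  ∀ t ≤ T, XiHat T ℱ C K 0 t ∩ selections P (fun ω => -K t ω) (ℱ t) ⊆
    selections P (fun ω => linealityPart (K t ω)) (ℱ t)

/-- No asymptotic risk arbitrage:
`(cl₀ Ξ_t^0) ∩ L⁰(ℝ_-^d, ℱ t) = {0}` for all `t = 0, …, T`. -/
def NARA (T : ℕ) (ℱ : Filtration ℕ m0) (C : ℕ → ℕ → Set (RV P d))
    (K : ℕ → Ω → Set (E d)) : Prop :=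
  ∀ t ≤ T, closureL0 (Xi T ℱ C K 0 t) ∩ L0neg P d (ℱ t) = {0}

end Model

end RiskArbitrage

end

/-! The heart of the matter is the closedness of `XiHat` at `t < T`, a sum of two closed
conditionally convex sets `A = L⁰(K_t, ℱ_t)` and `Q = R_{t,t+1}(Ξ_{t+1}^0)`, both containing zero.
Such a sum is closed once `a ∈ A` and `-a ∈ Q` force `a = 0` (`isClosedL0_add`).

Indeed, let sums from `A + Q` converge a.s. If the `A`-summands diverged in norm with positive
probability, dividing by their norms there and passing to a random subsequence would give a nonzero
limit in `A` whose negative lies in `Q` (`ae_frequently_norm_le`). So a.s. some subsequence is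
bounded, and along measurable random indices (`exists_measurable_indices_tendsto`) both summands
converge. Conditional convexity and closedness keep them in `A` and `Q` (`IsVersion.random_index`).

SNR and properness exclude opposite elements: such `-a` lies in both `XiHat` and `L⁰(-K_t, ℱ_t)`,
hence vanishes. NARA follows, since the closed set `XiHat` contains the closure of `Xi`, and `ℝ_-^d
⊆ -K_t`. -/

namespace RiskArbitrage

/-! ### Measurability of limits, norms and random indices -/

section Measurability

theorem stronglyMeasurable_limUnder_atTop {Ω F : Type*} {mΩ : MeasurableSpace Ω}
    [NormedAddCommGroup F] [CompleteSpace F] {f : ℕ → Ω → F} (hf : ∀ n, StronglyMeasurable (f n)) :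
    StronglyMeasurable fun ω => limUnder atTop fun n => f n ω :=
  StronglyMeasurable.limUnder hf

variable {Ω F : Type*} {mΩ : MeasurableSpace Ω} [NormedAddCommGroup F]
  [MeasurableSpace F] [BorelSpace F]

theorem measurableSet_tendsto_norm_atTop {f : ℕ → Ω → F} (hf : ∀ n, Measurable (f n)) :
    MeasurableSet {ω | Tendsto (fun n => ‖f n ω‖) atTop atTop} :=
  measurableSet_tendsto _ fun n => (hf n).norm

theorem measurable_inv_max_one_norm {f : Ω → F} (hf : Measurable f) :
    Measurable fun ω => (max 1 ‖f ω‖)⁻¹ :=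
  (measurable_const.max hf.norm).inv

theorem measurable_random_index {c : ℕ → Ω → ℝ} (hc : ∀ n, Measurable (c n)) {τ : Ω → ℕ}
    (hτ : Measurable τ) : Measurable fun ω => c (τ ω) ω :=
  Measurable.comp (g := fun q : ℕ × Ω => c q.1 q.2)
    (measurable_from_prod_countable_right hc) (hτ.prodMk measurable_id)

end Measurability

/-! ### Measurable random subsequences -/

section RandomSubsequence

variable {Ω F : Type*} {mΩ : MeasurableSpace Ω} [NormedAddCommGroup F] [ProperSpace F]
  [MeasurableSpace F] [BorelSpace F]

theorem measurableSet_frequently_atTop {p : ℕ → Ω → Prop}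
    (hp : ∀ n, MeasurableSet {ω | p n ω}) : MeasurableSet {ω | ∃ᶠ n in atTop, p n ω} := by
  simp only [frequently_atTop, Set.ofPred_forall, Set.ofPred_exists, Set.ofPred_and]
  exact MeasurableSet.iInter fun a => MeasurableSet.iUnion fun b =>
    (MeasurableSet.const _).inter (hp b)

theorem exists_measurable_nat_choice {p : ℕ → Ω → Prop}
    (hp : ∀ n, MeasurableSet {ω | p n ω}) :
    ∃ j : Ω → ℕ, Measurable j ∧ ∀ ω, (∃ n, p n ω) → p (j ω) ω := by
  classical
  -- The second alternative lets the least index be taken at every `ω`; it is `0` where no index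
  -- works.
  have hex : ∀ ω, ∃ n, p n ω ∨ ¬ ∃ k, p k ω := fun ω => by
    by_cases h : ∃ k, p k ω
    · exact ⟨h.choose, Or.inl h.choose_spec⟩
    · exact ⟨0, Or.inr h⟩
  refine ⟨fun ω => Nat.find (hex ω), measurable_find hex fun k => ?_, fun ω h => ?_⟩
  · have : MeasurableSet {ω | ∃ k, p k ω} := by
      rw [Set.ofPred_exists]; exact MeasurableSet.iUnion hp
    exact (hp k).union this.compl
  · exact (Nat.find_spec (hex ω)).resolve_right (not_not_intro h)

/-- A measurable set of indices that is visited infinitely often within a bounded region can be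
shrunk measurably to one on which the sequence oscillates by less than `r`. -/
theorem exists_measurable_refinement {f : ℕ → Ω → F} (hf : ∀ n, Measurable (f n))
    {p : ℕ → Ω → Prop} (hp : ∀ n, MeasurableSet {ω | p n ω}) {r : ℝ} (hr : 0 < r) :
    ∃ q : ℕ → Ω → Prop, (∀ n, MeasurableSet {ω | q n ω}) ∧ (∀ n ω, q n ω → p n ω) ∧
      (∀ ω n n', q n ω → q n' ω → dist (f n ω) (f n' ω) < r) ∧
      ∀ ω, (∃ R : ℝ, ∃ᶠ n in atTop, p n ω ∧ ‖f n ω‖ ≤ R) →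
        ∃ R : ℝ, ∃ᶠ n in atTop, q n ω ∧ ‖f n ω‖ ≤ R := by
  let e : ℕ → F := TopologicalSpace.denseSeq F
  have hball : ∀ n j, MeasurableSet {ω | p n ω ∧ f n ω ∈ Metric.ball (e j) (r / 2)} :=
    fun n j => (hp n).inter (hf n measurableSet_ball)
  -- `j ω` selects a ball of radius `r / 2` with centre in a dense sequence that is visited
  -- infinitely often, whenever there is one.
  obtain ⟨j, hj, hj'⟩ := exists_measurable_nat_choice
    (p := fun j ω => ∃ᶠ n in atTop, p n ω ∧ f n ω ∈ Metric.ball (e j) (r / 2))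
    (fun j => measurableSet_frequently_atTop fun n => hball n j)
  refine ⟨fun n ω => p n ω ∧ f n ω ∈ Metric.ball (e (j ω)) (r / 2), fun n => ?_,
    fun n ω h => h.1, fun ω n n' h h' => ?_, fun ω ⟨R, hR⟩ => ?_⟩
  · have : {ω | p n ω ∧ f n ω ∈ Metric.ball (e (j ω)) (r / 2)} =
        ⋃ i, (j ⁻¹' {i} ∩ {ω | p n ω ∧ f n ω ∈ Metric.ball (e i) (r / 2)}) := by
      ext ω; simp
    rw [this]
    exact MeasurableSet.iUnion fun i => (hj (measurableSet_singleton i)).inter (hball n i)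
  · calc dist (f n ω) (f n' ω) ≤ dist (f n ω) (e (j ω)) + dist (f n' ω) (e (j ω)) :=
          dist_triangle_right _ _ _
      _ < r / 2 + r / 2 := add_lt_add h.2 h'.2
      _ = r := add_halves r
  -- Finitely many of the balls cover the compact ball of radius `R`, so one of them is visited
  -- infinitely often.
  · have hex : ∃ i, ∃ᶠ n in atTop, p n ω ∧ f n ω ∈ Metric.ball (e i) (r / 2) := by
      by_contra hcon
      simp only [not_exists, not_frequently] at hcon
      have hcover : Metric.closedBall (0 : F) R ⊆ ⋃ i, Metric.ball (e i) (r / 2) := fun x _ => by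
        obtain ⟨i, hi⟩ := (TopologicalSpace.denseRange_denseSeq F).exists_dist_lt x (half_pos hr)
        exact Set.mem_iUnion.2 ⟨i, hi⟩
      obtain ⟨t, ht⟩ := (isCompact_closedBall (0 : F) R).elim_finite_subcover _
        (fun _ => Metric.isOpen_ball) hcover
      have hall : ∀ᶠ n in atTop, ∀ i ∈ t, ¬ (p n ω ∧ f n ω ∈ Metric.ball (e i) (r / 2)) :=
        (Finset.eventually_all t).2 fun i _ => hcon i
      obtain ⟨n, hn, hn'⟩ := (hR.and_eventually hall).exists
      have := ht (show f n ω ∈ Metric.closedBall (0 : F) R by simpa using hn.2)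
      simp only [Set.mem_iUnion] at this
      obtain ⟨i, hi, hmem⟩ := this
      exact hn' i hi ⟨hn.1, hmem⟩
    refine ⟨‖e (j ω)‖ + r / 2, (hj' ω hex).mono fun n hn => ⟨hn, ?_⟩⟩
    have h1 := norm_sub_norm_le (f n ω) (e (j ω))
    have h2 : ‖f n ω - e (j ω)‖ < r / 2 := by simpa [dist_eq_norm] using hn.2
    linarith

/-- A sequence of random vectors admits measurable random indices along which it converges at
every point where it has a bounded subsequence. -/
theorem exists_measurable_indices_tendsto {f : ℕ → Ω → F} (hf : ∀ n, Measurable (f n)) :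
    ∃ τ : ℕ → Ω → ℕ, (∀ m, Measurable (τ m)) ∧
      ∀ ω, (∃ R : ℝ, ∃ᶠ n in atTop, ‖f n ω‖ ≤ R) →
        Tendsto (fun m => τ m ω) atTop atTop ∧
        ∃ l, Tendsto (fun m => f (τ m ω) ω) atTop (𝓝 l) := by
  choose! q hqm hqp hqd hqR using
    fun (p : ℕ → Ω → Prop) (hp : ∀ n, MeasurableSet {ω | p n ω}) (m : ℕ) =>
      exists_measurable_refinement hf hp (r := 1 / ((m : ℝ) + 1)) (by positivity)
  -- Nested index sets: all indices at first, then stage `m + 1` refines stage `m` to oscillation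
  -- below `1 / (m + 1)`. The index `τ m` is taken from stage `m` and is at least `m`.
  let G : ℕ → ℕ → Ω → Prop := fun m => Nat.rec (fun _ _ => True) (fun m p => q p m) m
  have hGm : ∀ m n, MeasurableSet {ω | G m n ω} := fun m => by
    induction m with
    | zero => exact fun n => MeasurableSet.univ
    | succ m ih => exact hqm _ ih m
  have hGanti : ∀ n ω, Antitone fun m => G m n ω := fun n ω =>
    antitone_nat_of_succ_le fun m => hqp _ (hGm m) m n ω
  choose τ hτ hτ' using fun m => exists_measurable_nat_choice (p := fun n ω => m ≤ n ∧ G m n ω)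
    (fun n => (MeasurableSet.const _).inter (hGm m n))
  refine ⟨τ, hτ, fun ω hω => ?_⟩
  have hfreq : ∀ m, ∃ R : ℝ, ∃ᶠ n in atTop, G m n ω ∧ ‖f n ω‖ ≤ R := fun m => by
    induction m with
    | zero =>
      obtain ⟨R, hR⟩ := hω
      exact ⟨R, hR.mono fun n hn => ⟨trivial, hn⟩⟩
    | succ m ih => exact hqR _ (hGm m) m ω ih
  have hspec : ∀ m, m ≤ τ m ω ∧ G m (τ m ω) ω := fun m => by
    obtain ⟨R, hR⟩ := hfreq m
    obtain ⟨n, hn, hn'⟩ := (hR.and_eventually (eventually_ge_atTop m)).exists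
    exact hτ' m ω ⟨n, hn', hn.1⟩
  refine ⟨tendsto_atTop_mono (fun m => (hspec m).1) tendsto_id, ?_⟩
  refine cauchySeq_tendsto_of_complete (Metric.cauchySeq_iff.2 fun ε hε => ?_)
  obtain ⟨M, hM⟩ := exists_nat_one_div_lt hε
  exact ⟨M + 1, fun m hm n hn => (hqd _ (hGm M) M ω _ _ (hGanti _ ω hm (hspec m).2)
    (hGanti _ ω hn (hspec n).2)).trans hM⟩

end RandomSubsequence

/-! ### Random weights and conditional convexity -/

section Algebra

variable {Ω : Type*} {H G m0 : MeasurableSpace Ω} {P : Measure Ω} {d : ℕ}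

theorem coeFn_rsmul (α : Ω →ₘ[P] ℝ) (ξ : RV P d) :
    rsmul α ξ =ᵐ[P] fun ω => α ω • ξ ω :=
  AEEqFun.coeFn_comp₂ _ _ _ _

theorem rsmul_add (α : Ω →ₘ[P] ℝ) (ξ η : RV P d) :
    rsmul α (ξ + η) = rsmul α ξ + rsmul α η := by
  refine AEEqFun.ext ?_
  filter_upwards [coeFn_rsmul α (ξ + η), coeFn_rsmul α ξ, coeFn_rsmul α η,
    AEEqFun.coeFn_add ξ η, AEEqFun.coeFn_add (rsmul α ξ) (rsmul α η)] with ω h1 h2 h3 h4 h5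
  simp [h1, h2, h3, h4, h5]

theorem rsmul_sub (α : Ω →ₘ[P] ℝ) (ξ η : RV P d) :
    rsmul α (ξ - η) = rsmul α ξ - rsmul α η := by
  rw [eq_sub_iff_add_eq, ← rsmul_add, sub_add_cancel]

/-- The combination `α ξ + (1 - α) η` with a random weight. -/
theorem coeFn_convexComb (α : Ω →ₘ[P] ℝ) (ξ η : RV P d) :
    ⇑(rsmul α ξ + rsmul (1 - α) η) =ᵐ[P] fun ω => α ω • ξ ω + (1 - α ω) • η ω := by
  filter_upwards [coeFn_rsmul α ξ, coeFn_rsmul (1 - α) η, AEEqFun.coeFn_sub 1 α,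
    AEEqFun.coeFn_one (α := Ω) (μ := P) (β := ℝ),
    AEEqFun.coeFn_add (rsmul α ξ) (rsmul (1 - α) η)] with ω h1 h2 h3 h4 h5
  simp [h1, h2, h3, h4, h5]

/-- Convexity with respect to `𝓗`-measurable random weights. -/
def CondConvex (H : MeasurableSpace Ω) {m0 : MeasurableSpace Ω} {P : Measure Ω} {d : ℕ}
    (S : Set (RV P d)) : Prop :=
  ∀ α : Ω →ₘ[P] ℝ, AEStronglyMeasurable[H] α P → (∀ᵐ ω ∂P, 0 ≤ α ω ∧ α ω ≤ 1) →
    ∀ η' ∈ S, ∀ η'' ∈ S, rsmul α η' + rsmul (1 - α) η'' ∈ S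

theorem CondConvex.mono (hHG : H ≤ G) {S : Set (RV P d)}
    (hS : CondConvex G S) : CondConvex H S :=
  fun α hα => hS α (hα.mono hHG)

theorem CondConvex.add {A B : Set (RV P d)}
    (hA : CondConvex H A) (hB : CondConvex H B) : CondConvex H (A + B) := by
  rintro α hα h01 _ ⟨a, ha, b, hb, rfl⟩ _ ⟨a', ha', b', hb', rfl⟩
  refine ⟨_, hA α hα h01 a ha a' ha', _, hB α hα h01 b hb b' hb', ?_⟩
  simp only [rsmul_add]
  abel

theorem condConvex_L0 : CondConvex H (L0 P d H) := by
  intro α hα _ η' hη' η'' hη''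
  refine AEStronglyMeasurable.congr ?_ (coeFn_convexComb α η' η'').symm
  exact (hα.smul hη').add (((aestronglyMeasurable_const (b := (1 : ℝ))).sub hα).smul hη'')

theorem condConvex_selections {Γ : Ω → Set (E d)}
    (hΓ : ∀ᵐ ω ∂P, Convex ℝ (Γ ω)) : CondConvex H (selections P Γ H) := by
  intro α hα h01 η' hη' η'' hη''
  refine ⟨condConvex_L0 α hα h01 η' hη'.1 η'' hη''.1, ?_⟩
  filter_upwards [hΓ, h01, hη'.2, hη''.2, coeFn_convexComb α η' η''] with ω h1 h2 h3 h4 h5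
  rw [h5]
  exact h1 h3 h4 h2.1 (sub_nonneg.2 h2.2) (add_sub_cancel _ _)

theorem zero_mem_L0 : (0 : RV P d) ∈ L0 P d H :=
  AEStronglyMeasurable.congr (aestronglyMeasurable_const (b := (0 : E d)))
    AEEqFun.coeFn_zero.symm

theorem zero_mem_selections {Γ : Ω → Set (E d)}
    (hΓ : ∀ᵐ ω ∂P, (0 : E d) ∈ Γ ω) : (0 : RV P d) ∈ selections P Γ H := by
  refine ⟨zero_mem_L0, ?_⟩
  filter_upwards [hΓ, AEEqFun.coeFn_zero (μ := P) (β := E d)] with ω h1 h2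
  rwa [h2]

end Algebra

/-! ### Closure in probability -/

section Closure

variable {Ω : Type*} {H m0 : MeasurableSpace Ω} {P : Measure Ω} {d : ℕ}

theorem subset_closureL0 (S : Set (RV P d)) : S ⊆ closureL0 S := fun ξ hξ =>
  ⟨fun _ => ξ, fun _ => hξ, fun ε hε => by simp [hε.ne']⟩

theorem closureL0_mono {S S' : Set (RV P d)} (h : S ⊆ S') : closureL0 S ⊆ closureL0 S' :=
  fun _ ⟨u, hu, hlim⟩ => ⟨u, fun n => h (hu n), hlim⟩

/-- Approximation by single elements replaces sequences, so that idempotence of the closure needs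
only the triangle inequality and no diagonal sequence. -/
theorem mem_closureL0_iff_measure {S : Set (RV P d)} {ξ : RV P d} :
    ξ ∈ closureL0 S ↔ ∀ ε : ℝ≥0∞, 0 < ε → ∃ u ∈ S, P {ω | ε ≤ edist (u ω) (ξ ω)} ≤ ε := by
  constructor
  · rintro ⟨u, hu, hlim⟩ ε hε
    obtain ⟨n, hn⟩ := ((tendsto_order.1 (hlim ε hε)).2 ε hε).exists
    exact ⟨u n, hu n, hn.le⟩
  · intro h
    choose u hu hlim using fun n : ℕ => h ((n : ℝ≥0∞) + 1)⁻¹ (by simp)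
    refine ⟨u, hu, fun ε hε => ?_⟩
    have h0 : Tendsto (fun n : ℕ => ((n : ℝ≥0∞) + 1)⁻¹) atTop (𝓝 0) := by
      simpa using (tendsto_add_atTop_iff_nat 1).2 ENNReal.tendsto_inv_nat_nhds_zero
    refine tendsto_of_tendsto_of_tendsto_of_le_of_le' tendsto_const_nhds h0
      (Eventually.of_forall fun _ => zero_le) ?_
    filter_upwards [(tendsto_order.1 h0).2 ε hε] with n hn
    exact (measure_mono fun ω hω => hn.le.trans hω).trans (hlim n)

theorem isClosedL0_closureL0 (S : Set (RV P d)) : IsClosedL0 (closureL0 S) := by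
  intro ξ hξ
  rw [mem_closureL0_iff_measure] at hξ ⊢
  intro ε hε
  have hε2 : 0 < ε / 2 := ENNReal.half_pos hε.ne'
  obtain ⟨u, hu, hu'⟩ := hξ _ hε2
  obtain ⟨v, hv, hv'⟩ := mem_closureL0_iff_measure.1 hu _ hε2
  refine ⟨v, hv, ?_⟩
  calc P {ω | ε ≤ edist (v ω) (ξ ω)}
      ≤ P ({ω | ε / 2 ≤ edist (v ω) (u ω)} ∪ {ω | ε / 2 ≤ edist (u ω) (ξ ω)}) := by
        refine measure_mono fun ω hω => ?_
        by_contra hcon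
        simp only [Set.mem_union, Set.mem_ofPred_eq, not_or, not_le] at hcon hω
        have := (edist_triangle (v ω) (u ω) (ξ ω)).trans_lt (ENNReal.add_lt_add hcon.1 hcon.2)
        rw [ENNReal.add_halves] at this
        exact absurd hω this.not_ge
    _ ≤ ε / 2 + ε / 2 := (measure_union_le _ _).trans (add_le_add hv' hu')
    _ = ε := ENNReal.add_halves ε

variable [IsProbabilityMeasure P]

/-- Convergence in probability gives an a.s. convergent subsequence, and conversely on a probability
space; later limits can thus be taken pointwise. -/
theorem mem_closureL0_iff_ae {S : Set (RV P d)} {ξ : RV P d} :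
    ξ ∈ closureL0 S ↔ ∃ u : ℕ → RV P d, (∀ n, u n ∈ S) ∧
      ∀ᵐ ω ∂P, Tendsto (fun n => u n ω) atTop (𝓝 (ξ ω)) := by
  constructor
  · rintro ⟨u, hu, hlim⟩
    obtain ⟨ns, -, hns⟩ := hlim.exists_seq_tendsto_ae
    exact ⟨fun n => u (ns n), fun n => hu _, hns⟩
  · rintro ⟨u, hu, hlim⟩
    exact ⟨u, hu, tendstoInMeasure_of_tendsto_ae (fun n => (u n).aestronglyMeasurable) hlim⟩

theorem isClosedL0_L0 : IsClosedL0 (L0 P d H) := by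
  intro ξ hξ
  obtain ⟨u, hu, hlim⟩ := mem_closureL0_iff_ae.1 hξ
  -- The limit is formed from `H`-measurable versions, so that it is `H`-measurable even if `H`
  -- lacks the null sets.
  have hm : ∀ n, StronglyMeasurable[H] ((hu n).mk (u n)) := fun n => (hu n).stronglyMeasurable_mk
  refine ⟨fun ω => limUnder atTop fun n => (hu n).mk (u n) ω,
    stronglyMeasurable_limUnder_atTop hm, ?_⟩
  filter_upwards [hlim, ae_all_iff.2 fun n => (hu n).ae_eq_mk] with ω h1 h2
  simp only [h2] at h1
  exact h1.limUnder_eq.symm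

theorem isClosedL0_selections {Γ : Ω → Set (E d)}
    (hΓ : ∀ᵐ ω ∂P, IsClosed (Γ ω)) : IsClosedL0 (selections P Γ H) := by
  intro ξ hξ
  refine ⟨isClosedL0_L0 (closureL0_mono (fun _ h => h.1) hξ), ?_⟩
  obtain ⟨u, hu, hlim⟩ := mem_closureL0_iff_ae.1 hξ
  filter_upwards [hlim, hΓ, ae_all_iff.2 fun n => (hu n).2] with ω h1 h2 h3
  exact h2.mem_of_tendsto h1 (Eventually.of_forall h3)

theorem CondConvex.closureL0 {S : Set (RV P d)} (hS : CondConvex H S) :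
    CondConvex H (closureL0 S) := by
  intro α hα h01 ξ hξ η hη
  obtain ⟨u, hu, hu'⟩ := mem_closureL0_iff_ae.1 hξ
  obtain ⟨v, hv, hv'⟩ := mem_closureL0_iff_ae.1 hη
  refine mem_closureL0_iff_ae.2 ⟨_, fun n => hS α hα h01 _ (hu n) _ (hv n), ?_⟩
  filter_upwards [hu', hv', coeFn_convexComb α ξ η,
    ae_all_iff.2 fun n => coeFn_convexComb α (u n) (v n)] with ω h1 h2 h3 h4
  simp only [h3, h4]
  exact (h1.const_smul _).add (h2.const_smul _)

end Closure

/-! ### Pointwise versions and random indices -/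

section Representatives

variable {Ω : Type*} {H m0 : MeasurableSpace Ω} {P : Measure Ω} {d : ℕ}

/-- `f` is a version of an element of `S`. -/
def IsVersion (S : Set (RV P d)) (f : Ω → E d) : Prop := ∃ a ∈ S, ⇑a =ᵐ[P] f

variable {S : Set (RV P d)}

theorem IsVersion.convexComb (hH : H ≤ m0) (hS : CondConvex H S) {f g : Ω → E d}
    (hf : IsVersion S f) (hg : IsVersion S g) {α : Ω → ℝ} (hα : Measurable[H] α)
    (h01 : ∀ ω, 0 ≤ α ω ∧ α ω ≤ 1) : IsVersion S fun ω => α ω • f ω + (1 - α ω) • g ω := by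
  obtain ⟨a, ha, haf⟩ := hf
  obtain ⟨b, hb, hbg⟩ := hg
  have hαP : AEStronglyMeasurable α P := (hα.mono hH le_rfl).aestronglyMeasurable (m := m0)
  have hmk := AEEqFun.coeFn_mk α hαP
  refine ⟨_, hS (AEEqFun.mk α hαP) ?_ ?_ a ha b hb, ?_⟩
  · exact ⟨α, hα.stronglyMeasurable, hmk⟩
  · filter_upwards [hmk] with ω h
    rw [h]; exact h01 ω
  · filter_upwards [coeFn_convexComb (AEEqFun.mk α hαP) a b, hmk, haf, hbg] with ω h1 h2 h3 h4
    rw [h1, h2, h3, h4]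

theorem isVersion_zero (h0 : 0 ∈ S) : IsVersion S fun _ => 0 :=
  ⟨0, h0, AEEqFun.coeFn_zero⟩

theorem IsVersion.smul (hH : H ≤ m0) (hS : CondConvex H S) (h0 : 0 ∈ S) {f : Ω → E d}
    (hf : IsVersion S f) {α : Ω → ℝ} (hα : Measurable[H] α)
    (h01 : ∀ ω, 0 ≤ α ω ∧ α ω ≤ 1) : IsVersion S fun ω => α ω • f ω := by
  simpa using hf.convexComb hH hS (isVersion_zero h0) hα h01

variable [IsProbabilityMeasure P]

theorem IsVersion.of_tendsto (hcl : IsClosedL0 S) {f : ℕ → Ω → E d} {g : Ω → E d}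
    (hf : ∀ n, IsVersion S (f n))
    (hlim : ∀ᵐ ω ∂P, Tendsto (fun n => f n ω) atTop (𝓝 (g ω))) : IsVersion S g := by
  choose a ha haf using hf
  have hlim' : ∀ᵐ ω ∂P, Tendsto (fun n => a n ω) atTop (𝓝 (g ω)) := by
    filter_upwards [hlim, ae_all_iff.2 haf] with ω h1 h2
    simpa only [h2] using h1
  have hg : AEStronglyMeasurable g P :=
    aestronglyMeasurable_of_tendsto_ae atTop (fun n => (a n).aestronglyMeasurable) hlim'
  have hmk := AEEqFun.coeFn_mk g hg
  refine ⟨AEEqFun.mk g hg, hcl (mem_closureL0_iff_ae.2 ⟨a, ha, ?_⟩), hmk⟩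
  filter_upwards [hlim', hmk] with ω h1 h2
  rwa [h2]

/-- A closed conditionally convex set is stable under measurable random choice of an index. -/
theorem IsVersion.random_index (hH : H ≤ m0) (hcl : IsClosedL0 S) (hS : CondConvex H S)
    (h0 : 0 ∈ S) {f : ℕ → Ω → E d} (hf : ∀ n, IsVersion S (f n)) {τ : Ω → ℕ}
    (hτ : Measurable[H] τ) : IsVersion S fun ω => f (τ ω) ω := by
  classical
  -- Truncating to `τ < N` leaves finitely many pieces, glued one at a time with indicator weights;
  -- closedness then lets `N → ∞`.
  have key : ∀ N, IsVersion S fun ω => if τ ω < N then f (τ ω) ω else 0 := fun N => by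
    induction N with
    | zero => simpa using isVersion_zero h0
    | succ N ih =>
      have hm : Measurable[H] fun ω => if τ ω = N then (1 : ℝ) else 0 :=
        Measurable.ite (hτ (measurableSet_singleton N)) measurable_const measurable_const
      have := (hf N).convexComb hH hS ih hm fun ω => by split_ifs <;> simp
      refine cast (congrArg _ (funext fun ω => ?_)) this
      by_cases h : τ ω = N
      · simp [h]
      · have : τ ω < N + 1 ↔ τ ω < N := by omega
        simp [h, this]
  refine IsVersion.of_tendsto hcl key (Eventually.of_forall fun ω => ?_)
  refine tendsto_const_nhds.congr' ?_
  filter_upwards [eventually_gt_atTop (τ ω)] with N hN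
  simp [hN]

end Representatives

/-! ### Closedness of sums -/

section Sum

variable {Ω : Type*} {H m0 : MeasurableSpace Ω} {P : Measure Ω} [IsProbabilityMeasure P] {d : ℕ}

/-- Summands of a convergent sequence from two closed conditionally convex sets do not escape to
infinity if these sets contain no nonzero opposite elements. -/
theorem ae_frequently_norm_le (hH : H ≤ m0) {A Q : Set (RV P d)}
    (hAcl : IsClosedL0 A) (hQcl : IsClosedL0 Q)
    (hA : CondConvex H A) (hQ : CondConvex H Q) (hA0 : 0 ∈ A) (hQ0 : 0 ∈ Q)
    (hAQ : ∀ a ∈ A, -a ∈ Q → a = 0) {f g : ℕ → Ω → E d} {ζ : Ω → E d}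
    (hf : ∀ n, Measurable[H] (f n)) (hfA : ∀ n, IsVersion A (f n))
    (hgQ : ∀ n, IsVersion Q (g n))
    (hfg : ∀ᵐ ω ∂P, Tendsto (fun n => f n ω + g n ω) atTop (𝓝 (ζ ω))) :
    ∀ᵐ ω ∂P, ∃ R : ℝ, ∃ᶠ n in atTop, ‖f n ω‖ ≤ R := by
  classical
  let D : Set Ω := {ω | Tendsto (fun n => ‖f n ω‖) atTop atTop}
  have hDm : MeasurableSet[H] D := measurableSet_tendsto_norm_atTop hf
  -- The maximum with `1` keeps the scaling factor in `[0, 1]`, hence a legitimate convex weight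
  -- against zero; on `D` it is eventually the inverse norm.
  obtain ⟨c, hc⟩ : ∃ c : ℕ → Ω → ℝ, ∀ n ω, c n ω = (max 1 ‖f n ω‖)⁻¹ := ⟨_, fun _ _ => rfl⟩
  have hcm : ∀ n, Measurable[H] (c n) := fun n => by
    rw [funext (hc n)]
    exact measurable_inv_max_one_norm (hf n)
  have hc0 : ∀ n ω, 0 ≤ c n ω := fun n ω => by rw [hc]; positivity
  have hc1 : ∀ n ω, c n ω ≤ 1 := fun n ω => by
    rw [hc]; exact inv_le_one_of_one_le₀ (le_max_left _ _)
  have hv : ∀ n ω, ‖c n ω • f n ω‖ ≤ 1 := fun n ω => by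
    rw [norm_smul, Real.norm_of_nonneg (hc0 n ω), hc]
    exact inv_mul_le_one_of_le₀ (le_max_right _ _) (by positivity)
  obtain ⟨τ, hτ, hτ'⟩ := exists_measurable_indices_tendsto (f := fun n ω => c n ω • f n ω)
    (fun n => (hcm n).smul (hf n))
  choose hτtop L hL using fun ω =>
    hτ' ω ⟨1, (Eventually.of_forall fun n => hv n ω).frequently⟩
  obtain ⟨α, hα⟩ : ∃ α : ℕ → Ω → ℝ, ∀ m, α m = D.indicator fun ω => c (τ m ω) ω :=
    ⟨_, fun _ => rfl⟩
  have hαm : ∀ m, Measurable[H] (α m) := fun m => by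
    rw [hα]
    exact Measurable.indicator (measurable_random_index hcm (hτ m)) hDm
  have hα01 : ∀ m ω, 0 ≤ α m ω ∧ α m ω ≤ 1 := fun m ω => by
    by_cases hω : ω ∈ D <;> simp [hα, hω, hc0, hc1]
  have hAm : ∀ m, IsVersion A fun ω => α m ω • f (τ m ω) ω := fun m =>
    (IsVersion.random_index hH hAcl hA hA0 hfA (hτ m)).smul hH hA hA0 (hαm m) (hα01 m)
  have hQm : ∀ m, IsVersion Q fun ω => α m ω • g (τ m ω) ω := fun m =>
    (IsVersion.random_index hH hQcl hQ hQ0 hgQ (hτ m)).smul hH hQ hQ0 (hαm m) (hα01 m)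
  have hAL : IsVersion A (D.indicator L) := by
    refine IsVersion.of_tendsto hAcl hAm (Eventually.of_forall fun ω => ?_)
    by_cases hω : ω ∈ D
    · simpa [hα, hω] using hL ω
    · simp [hα, hω]
  -- On `D` the factors tend to zero, so the scaled sums vanish in the limit and the scaled
  -- `Q`-parts tend to `-L`.
  have hQL : IsVersion Q (-D.indicator L) := by
    refine IsVersion.of_tendsto hQcl hQm ?_
    filter_upwards [hfg] with ω hω'
    by_cases hω : ω ∈ D
    · have hclim : Tendsto (fun n => c n ω) atTop (𝓝 0) := by
        simp only [hc]
        exact (tendsto_atTop_mono (fun n => le_max_right _ _) hω).inv_tendsto_atTop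
      have := ((hclim.smul hω').comp (hτtop ω)).sub (hL ω)
      simpa [hα, hω, Function.comp_def] using this
    · simp [hα, hω]
  obtain ⟨a, ha, haL⟩ := hAL
  obtain ⟨b, hb, hbL⟩ := hQL
  have hba : b = -a := by
    refine AEEqFun.ext ?_
    filter_upwards [haL, hbL, AEEqFun.coeFn_neg a] with ω h1 h2 h3
    simp [h1, h2, h3]
  have ha0 := hAQ a ha (hba ▸ hb)
  filter_upwards [haL, AEEqFun.coeFn_zero (μ := P) (β := E d)] with ω h1 h2
  -- On `D` the limit `L` has norm one, which contradicts `a = 0`; hence `D` is null.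
  have hω : ω ∉ D := fun hω => by
    rw [ha0, h2, Set.indicator_of_mem hω] at h1
    have hone : Tendsto (fun m => ‖c (τ m ω) ω • f (τ m ω) ω‖) atTop (𝓝 1) := by
      refine tendsto_const_nhds.congr' ?_
      filter_upwards [(hτtop ω).eventually (hω.eventually_ge_atTop 1)] with m hm
      have hpos : ‖f (τ m ω) ω‖ ≠ 0 := by positivity
      rw [norm_smul, Real.norm_of_nonneg (hc0 _ _), hc, max_eq_right hm, inv_mul_cancel₀ hpos]
    have := tendsto_nhds_unique hone (hL ω).norm
    rw [← h1] at this
    simp at this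
  by_contra! hcon
  refine hω (tendsto_atTop.2 fun R => ?_)
  filter_upwards [hcon R] with n hn
  exact hn.le

/-- The sum of two closed conditionally convex sets is closed if they contain no nonzero opposite
elements. -/
theorem isClosedL0_add (hH : H ≤ m0) {A Q : Set (RV P d)}
    (hAH : A ⊆ L0 P d H) (hAcl : IsClosedL0 A) (hQcl : IsClosedL0 Q)
    (hA : CondConvex H A) (hQ : CondConvex H Q) (hA0 : 0 ∈ A) (hQ0 : 0 ∈ Q)
    (hAQ : ∀ a ∈ A, -a ∈ Q → a = 0) : IsClosedL0 (A + Q) := by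
  intro ζ hζ
  obtain ⟨u, hu, hlim⟩ := mem_closureL0_iff_ae.1 hζ
  choose k hk q hq hkq using hu
  -- Random indices are built from the `A`-parts alone, so only these need `H`-measurable versions.
  choose f hfm hfk using fun n => hAH (hk n)
  have hf : ∀ n, Measurable[H] (f n) := fun n => (hfm n).measurable
  have hfA : ∀ n, IsVersion A (f n) := fun n => ⟨k n, hk n, hfk n⟩
  have hgQ : ∀ n, IsVersion Q (q n) := fun n => ⟨q n, hq n, ae_eq_rfl⟩
  have hfg : ∀ᵐ ω ∂P, Tendsto (fun n => f n ω + q n ω) atTop (𝓝 (ζ ω)) := by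
    filter_upwards [hlim, ae_all_iff.2 hfk,
      ae_all_iff.2 fun n => AEEqFun.coeFn_add (k n) (q n)] with ω h1 h2 h3
    refine h1.congr fun n => ?_
    rw [← hkq n, h3 n, Pi.add_apply, h2 n]
  obtain ⟨τ, hτ, hτ'⟩ := exists_measurable_indices_tendsto hf
  have hconv : ∀ᵐ ω ∂P, Tendsto (fun m => τ m ω) atTop atTop ∧
      ∃ l, Tendsto (fun m => f (τ m ω) ω) atTop (𝓝 l) :=
    (ae_frequently_norm_le hH hAcl hQcl hA hQ hA0 hQ0 hAQ hf hfA hgQ hfg).mono hτ'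
  let L : Ω → E d := fun ω => limUnder atTop fun m => f (τ m ω) ω
  have hL : ∀ᵐ ω ∂P, Tendsto (fun m => f (τ m ω) ω) atTop (𝓝 (L ω)) := by
    filter_upwards [hconv] with ω hω
    exact tendsto_nhds_limUnder hω.2
  obtain ⟨a, ha, haL⟩ : IsVersion A L := IsVersion.of_tendsto hAcl
    (fun m => IsVersion.random_index hH hAcl hA hA0 hfA (hτ m)) hL
  -- The `Q`-parts converge along the same indices because the sums do.
  obtain ⟨b, hb, hbL⟩ : IsVersion Q fun ω => ζ ω - L ω := by
    refine IsVersion.of_tendsto hQcl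
      (fun m => IsVersion.random_index hH hQcl hQ hQ0 hgQ (hτ m)) ?_
    filter_upwards [hL, hconv, hfg] with ω h1 h2 h3
    simpa [Function.comp_def] using (h3.comp h2.1).sub h1
  refine ⟨a, ha, b, hb, AEEqFun.ext ?_⟩
  filter_upwards [haL, hbL, AEEqFun.coeFn_add a b] with ω h1 h2 h3
  simp [h1, h2, h3]

end Sum

/-! ### Superhedging prices of zero -/

section Prices

variable {Ω : Type*} {m0 : MeasurableSpace Ω} {P : Measure Ω} {d T : ℕ} {ℱ : Filtration ℕ m0}
  {C : ℕ → ℕ → Set (RV P d)} {K : ℕ → Ω → Set (E d)} {p : ℝ≥0∞}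

theorem condConvex_R0 {t s : ℕ} (hC : CondConvex (ℱ t) (C t s)) {Ξ : Set (RV P d)}
    (hΞ : CondConvex (ℱ t) Ξ) : CondConvex (ℱ t) (R0 ℱ C t s Ξ) := by
  rintro α hα h01 γ ⟨hγ, ξ, hξ, hγξ⟩ γ' ⟨hγ', ξ', hξ', hγξ'⟩
  refine ⟨condConvex_L0 α hα h01 γ hγ γ' hγ', _, hΞ α hα h01 ξ hξ ξ' hξ', ?_⟩
  convert hC α hα h01 _ hγξ _ hγξ' using 1
  simp only [rsmul_sub]
  abel

theorem zero_mem_R0 {t s : ℕ} (hC : 0 ∈ C t s) {Ξ : Set (RV P d)} (hΞ : 0 ∈ Ξ) :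
    0 ∈ R0 ℱ C t s Ξ :=
  ⟨zero_mem_L0, 0, hΞ, by simpa using hC⟩

theorem IsAcceptance.condConvex (hC : IsAcceptance P d T ℱ p C) {t s : ℕ} (hts : t ≤ s)
    (hs : s ≤ T) : CondConvex (ℱ t) (C t s) :=
  hC.cond_convex t s hts hs

theorem IsAcceptance.zero_mem (hC : IsAcceptance P d T ℱ p C) {t s : ℕ} (hts : t ≤ s)
    (hs : s ≤ T) : 0 ∈ C t s :=
  hC.normal_pos t s hts hs (zero_mem_selections (Eventually.of_forall fun _ _ => le_rfl))

theorem IsSolvency.zero_mem (hK : IsSolvency P d T ℱ K) {t : ℕ} (ht : t ≤ T) :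
    ∀ᵐ ω ∂P, (0 : E d) ∈ K t ω := by
  filter_upwards [hK.inter_neg t ht] with ω h
  exact (h.ge (Set.mem_singleton 0)).1

theorem IsSolvency.orthant_subset (hK : IsSolvency P d T ℱ K) {t : ℕ} (ht : t ≤ T) :
    ∀ᵐ ω ∂P, orthant d ⊆ K t ω := by
  filter_upwards [hK.zero_mem ht, hK.upper t ht] with ω h0 hu x hx
  exact hu ⟨0, h0, x, hx, zero_add x⟩

theorem Xi_of_lt {t : ℕ} (ht : t < T) (ξ : RV P d) : Xi T ℱ C K ξ t =
    selections P (K t) (ℱ t) + R0 ℱ C t (t + 1) (Xi T ℱ C K ξ (t + 1)) := by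
  rw [Xi, if_pos ht]

theorem Xi_zero_terminal : Xi T ℱ C K 0 T = selections P (K T) (ℱ T) := by
  rw [Xi, if_neg (lt_irrefl T)]
  ext η
  refine and_congr_right fun _ => eventually_congr ?_
  filter_upwards [AEEqFun.coeFn_zero (μ := P) (β := E d)] with ω h
  simp [h]

theorem XiHat_of_lt {t : ℕ} (ht : t < T) (ξ : RV P d) : XiHat T ℱ C K ξ t =
    selections P (K t) (ℱ t) + R ℱ C t (t + 1) (Xi T ℱ C K ξ (t + 1)) := by
  rw [XiHat, if_pos ht]

theorem XiHat_zero_terminal : XiHat T ℱ C K 0 T = selections P (K T) (ℱ T) := by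
  rw [XiHat, if_neg (lt_irrefl T), Xi_zero_terminal]

/-- Backward induction from `T`: convexity for `ℱ_{t+1}`-measurable weights includes that for
`ℱ_t`-measurable ones, so it passes to `R0`. -/
theorem zero_mem_Xi_and_condConvex_Xi (hC : IsAcceptance P d T ℱ p C)
    (hK : IsSolvency P d T ℱ K) {t : ℕ} (ht : t ≤ T) :
    0 ∈ Xi T ℱ C K 0 t ∧ CondConvex (ℱ t) (Xi T ℱ C K 0 t) := by
  induction ht using Nat.decreasingInduction with
  | self =>
    rw [Xi_zero_terminal]
    exact ⟨zero_mem_selections (hK.zero_mem le_rfl),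
      condConvex_selections (hK.convex T le_rfl)⟩
  | @of_succ t ht ih =>
    rw [Xi_of_lt ht]
    refine ⟨⟨0, zero_mem_selections (hK.zero_mem ht.le), 0,
      zero_mem_R0 (hC.zero_mem (Nat.le_succ t) ht) ih.1, add_zero 0⟩, ?_⟩
    exact (condConvex_selections (hK.convex t ht.le)).add
      (condConvex_R0 (hC.condConvex (Nat.le_succ t) ht)
        (ih.2.mono (ℱ.mono (Nat.le_succ t))))

theorem Xi_zero_subset_XiHat {t : ℕ} (ht : t ≤ T) : Xi T ℱ C K 0 t ⊆ XiHat T ℱ C K 0 t := by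
  rcases ht.lt_or_eq with h | rfl
  · rw [Xi_of_lt h, XiHat_of_lt h]
    exact Set.add_subset_add_left (subset_closureL0 _)
  · rw [Xi_zero_terminal, XiHat_zero_terminal]

/-- Under strict no risk arbitrage with proper solvency sets, the only asymptotic superhedging
price of zero in `L⁰(-K_t, ℱ_t)` is zero. -/
theorem SNR.eq_zero (hSNR : SNR T ℱ C K) (hproper : IsProper P T K) {t : ℕ} (ht : t ≤ T)
    {ζ : RV P d} (hζ : ζ ∈ XiHat T ℱ C K 0 t) (hζ' : ζ ∈ selections P (fun ω => -K t ω) (ℱ t)) :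
    ζ = 0 := by
  refine AEEqFun.ext ?_
  filter_upwards [(hSNR t ht ⟨hζ, hζ'⟩).2, hproper t ht,
    AEEqFun.coeFn_zero (μ := P) (β := E d)] with ω h1 h2 h3
  rw [h2] at h1
  rw [h3]
  exact h1

variable [IsProbabilityMeasure P]

theorem isClosedL0_XiHat_zero (hC : IsAcceptance P d T ℱ p C) (hK : IsSolvency P d T ℱ K)
    (hproper : IsProper P T K) (hSNR : SNR T ℱ C K) {t : ℕ} (ht : t ≤ T) :
    IsClosedL0 (XiHat T ℱ C K 0 t) := by
  have hcl := isClosedL0_selections (H := ℱ t) (hK.closed t ht)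
  rcases ht.lt_or_eq with h | rfl
  · obtain ⟨h0, hconv⟩ := zero_mem_Xi_and_condConvex_Xi hC hK (Nat.succ_le_of_lt h)
    have hA0 := zero_mem_selections (H := ℱ t) (hK.zero_mem ht)
    rw [XiHat_of_lt h]
    refine isClosedL0_add (ℱ.le t) (fun _ h => h.1) hcl (isClosedL0_closureL0 _)
      (condConvex_selections (hK.convex t ht))
      (condConvex_R0 (hC.condConvex (Nat.le_succ t) h)
        (hconv.mono (ℱ.mono (Nat.le_succ t)))).closureL0 hA0
      (subset_closureL0 _ (zero_mem_R0 (hC.zero_mem (Nat.le_succ t) h) h0)) fun a ha ha' => ?_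
    -- With zero as the portfolio in `K_t`, the element `-a` is an asymptotic price lying in `-K_t`,
    -- so SNR applies to it.
    refine neg_eq_zero.1 (hSNR.eq_zero hproper ht ?_ ⟨?_, ?_⟩)
    · rw [XiHat_of_lt h]
      exact ⟨0, hA0, -a, ha', zero_add _⟩
    · exact ha.1.neg.congr (AEEqFun.coeFn_neg a).symm
    · filter_upwards [ha.2, AEEqFun.coeFn_neg a] with ω h1 h2
      simpa [h2] using h1
  · rwa [XiHat_zero_terminal]

end Prices

end RiskArbitrage

/-! ### The theorem -/

open RiskArbitrage in
theorem mainTheorem1 {Ω : Type*} {m0 : MeasurableSpace Ω} (P : Measure Ω)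
    [IsProbabilityMeasure P] (d T : ℕ) (ℱ : Filtration ℕ m0) (p : ℝ≥0∞) (hp : 1 ≤ p)
    (C : ℕ → ℕ → Set (RV P d)) (hC : IsAcceptance P d T ℱ p C)
    (K : ℕ → Ω → Set (E d)) (hK : IsSolvency P d T ℱ K) (hproper : IsProper P T K)
    (hSNR : SNR T ℱ C K) :
    NARA T ℱ C K ∧ ∀ t ≤ T, IsClosedL0 (XiHat T ℱ C K 0 t) := by
  have hcl : ∀ t ≤ T, IsClosedL0 (XiHat T ℱ C K 0 t) := fun t ht =>
    isClosedL0_XiHat_zero hC hK hproper hSNR ht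
  refine ⟨fun t ht => Set.Subset.antisymm ?_ ?_, hcl⟩
  · rintro ζ ⟨hζ, hζneg⟩
    refine hSNR.eq_zero hproper ht (hcl t ht (closureL0_mono (Xi_zero_subset_XiHat ht) hζ))
      ⟨hζneg.1, ?_⟩
    filter_upwards [hζneg.2, hK.orthant_subset ht] with ω h1 h2
    exact Set.neg_subset_neg.2 h2 h1
  · rintro _ rfl
    refine ⟨subset_closureL0 _ (zero_mem_Xi_and_condConvex_Xi hC hK ht).1,
      zero_mem_selections (Eventually.of_forall fun _ i => ?_)⟩
    simp
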